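/- For a positive integer $m$, let $\Omega_m=\{0,1,-1,\dots,m,-m\}$ and let $\mathfrak{B}_m$ be the hyperoctahedral group of signed permutations of length $m$, i.e. the bijections $\pi:\Omega_m\to\Omega_m$ with $\pi(-a)=-\pi(a)$ for all $a\in\Omega_m$. A fixed-point-free signed involution is an element $\pi\in\mathfrak{B}_m$ with $\pi^{-1}=\pi$ such that $\pi(i)\ne i$ and $\pi(i)\ne -i$ for every $i\in\{1,\dots,m\}$. The number of natural-order descents of $\pi$ is $$\mathrm{des}^B(\pi)=\#\{\,i\in\{0,1,\dots,m-1\} : \pi(i)>\pi(i+1)\,\},$$ where $\pi(0)=0$ and $>$ is the usual order on $\mathbb{Z}$. For an integer $k$, let $J^{\overline{B}}_{m,k}$ be the number of fixed-point-free signed involutions $\pi\in\mathfrak{B}_m$ with $\mathrm{des}^B(\pi)=k$. **Theorem.** For all integers $n\ge 2$ and $k\ge 0$, $$\begin{aligned} n\,J^{\overline{B}}_{2n,k}={}&(k^2+k+n-1)\,J^{\overline{B}}_{2n-2,k}+2\bigl((k-1)(2n-k-1)+n\bigr)\,J^{\overline{B}}_{2n-2,k-1}\\&+\bigl((2n-k)(2n-k+1)+(n-1)\bigr)\,J^{\overline{B}}_{2n-2,k-2}.\end{aligned}$$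 Moreover $J^{\overline{B}}_{2,0}=0$, $J^{\overline{B}}_{2,1}=2$, $J^{\overline{B}}_{2,2}=0$, and $J^{\overline{B}}_{2n,k}=0$ for all $n\ge1$ and $k<0$. -/

import Mathlib

/-- `Ω_n = {0, 1, -1, …, n, -n}`, ordered by the natural order of `ℤ`. -/
abbrev SignedSet (n : ℕ) : Type := {a : ℤ // a ∈ Finset.Icc (-(n : ℤ)) n}

instance SignedSet.instNeg (n : ℕ) : Neg (SignedSet n) :=
  ⟨fun a => ⟨-a.1, by
    have h := Finset.mem_Icc.1 a.2
    exact Finset.mem_Icc.2 ⟨by omega, by omega⟩⟩⟩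

/-- The group `𝔅_n` of signed permutations of length `n`: the bijections `π : Ω_n → Ω_n` such that
`π(a) = b` implies `π(-a) = -b`. -/
def SignedPerm (n : ℕ) : Subgroup (Equiv.Perm (SignedSet n)) where
  carrier := {π | ∀ a, π (-a) = -π a}
  one_mem' := fun _ => rfl
  mul_mem' := by
    intro π σ hπ hσ a
    change π (σ (-a)) = -π (σ a)
    rw [hσ, hπ]
  inv_mem' := by
    intro π hπ a
    change π.symm (-a) = -π.symm a
    rw [Equiv.symm_apply_eq, hπ, Equiv.apply_symm_apply]

namespace SignedPerm

/-- The element `i` of `Ω_n`, for `i ∈ {0, 1, …, n}`. -/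
def pos {n : ℕ} (i : Fin (n + 1)) : SignedSet n :=
  ⟨(i.val : ℤ), by
    have h := i.isLt
    exact Finset.mem_Icc.2 ⟨by omega, by omega⟩⟩

/-- The descent set in the natural order: all `i ∈ {0, …, n-1}` with `π_i > π_{i+1}`
(here `π_0 = π(0) = 0`). -/
def descentSet {n : ℕ} (π : SignedPerm n) : Finset (Fin n) :=
  Finset.univ.filter fun i => (π.1 (pos i.castSucc) : ℤ) > (π.1 (pos i.succ) : ℤ)

/-- The number of natural-order descents. -/
def des {n : ℕ} (π : SignedPerm n) : ℕ := (descentSet π).card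

/-- `π` is a fixed-point-free signed involution: `π⁻¹ = π`, and `π(i) ≠ i` and `π(i) ≠ -i` for
each `i ∈ {1, …, n}`. -/
def IsFixedPointFreeInvolution {n : ℕ} (π : SignedPerm n) : Prop :=
  π⁻¹ = π ∧ ∀ i : Fin n, π.1 (pos i.succ) ≠ pos i.succ ∧ π.1 (pos i.succ) ≠ -pos i.succ

/-- The number of fixed-point-free signed involutions in `𝔅_n` with exactly `k` natural-order
descents; the index `k` is an integer. -/
noncomputable def numFPFInvolutions (n : ℕ) (k : ℤ) : ℕ :=
  {π : SignedPerm n | IsFixedPointFreeInvolution π ∧ (des π : ℤ) = k}.ncard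

end SignedPerm

/-! Write J(2n,k) for the number of fixed-point-free involutions with k descents. Everything follows
from the expansion, for all r ≥ 0 and n ≥ 1, ∑_k J(2n,k) · C(r+2n-k, 2n) = C(r(r+1)+n-1, n),
obtained by counting in two ways the pairs (π, a) where a is an odd labelling of Ω by [-r, r] that
is `Compatible` with π.

For fixed π, a labelling is a weakly increasing sequence from 0 to at most r that must increase
strictly at the descents, which gives the left side (`ncard_compatible`). Conversely, the pair is
determined by the matrix M(c,d) = #{x : a x = c, a (π x) = d}: listing the triples (c,d,k), k <
M(c,d), lexicographically recovers Ω, and π exchanges c and d. The matrices that occur are those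
invariant under transposition and (c,d) ↦ (-c,-d), with M(0,0) = 1, zero elsewhere on the diagonal
and even elsewhere on the antidiagonal. They amount to arbitrary multiplicities of total n on a
fundamental domain of r(r+1) points, which gives the right side (`ncard_involution_compatible`).

The right side satisfies n·C(x+n-1, n) = (x+n-1)·C(x+n-2, n-1) with x = r(r+1). Multiplying
C(r+2n-2-k, 2n-2) by r²+r+n-1 gives three consecutive binomials of lower index 2n
(`Int.choose_three_term`). Comparing coefficients, which the values at all r determine, yields the
recurrence. -/

/-! ### Binomial identities and the passage from the expansion to the recurrence -/

theorem Int.choose_shift_two (M s : ℕ) :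
    (((s + M + 2).choose (M + 2) : ℕ) : ℤ) * ((M + 1) * (M + 2)) =
      ((s + M).choose M : ℕ) * ((s + M + 1) * (s + M + 2)) := by
  have h1 := Nat.add_one_mul_choose_eq (s + M) M
  have h2 := Nat.add_one_mul_choose_eq (s + M + 1) (M + 1)
  zify at h1 h2
  have e : (s : ℤ) + M + 1 + 1 = s + M + 2 := by ring
  have e' : (M : ℤ) + 1 + 1 = M + 2 := by ring
  rw [e, e'] at h2
  calc _ = (((s + M + 1 + 1).choose (M + 1 + 1) : ℕ) : ℤ) * (M + 2) * (M + 1) := by ring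
    _ = (s + M + 2) * (((s + M + 1).choose (M + 1) : ℕ) * (M + 1)) := by rw [← h2]; ring
    _ = _ := by rw [← h1]; ring

theorem Int.choose_shift_one (M s : ℕ) :
    (((s + M + 1).choose (M + 2) : ℕ) : ℤ) * ((M + 1) * (M + 2)) =
      ((s + M).choose M : ℕ) * ((s + M + 1) * s) := by
  have h1 := Nat.add_one_mul_choose_eq (s + M) M
  have h2 := Nat.choose_succ_right_eq (s + M + 1) (M + 1)
  rw [show s + M + 1 - (M + 1) = s by omega] at h2
  zify at h1 h2
  have e' : (M : ℤ) + 1 + 1 = M + 2 := by ring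
  rw [e'] at h2
  calc _ = (((s + M + 1).choose (M + 1 + 1) : ℕ) : ℤ) * (M + 2) * (M + 1) := by ring
    _ = s * (((s + M + 1).choose (M + 1) : ℕ) * (M + 1)) := by rw [h2]; ring
    _ = _ := by rw [← h1]; ring

theorem Int.choose_shift_zero (M s : ℕ) :
    (((s + M).choose (M + 2) : ℕ) : ℤ) * ((M + 1) * (M + 2)) =
      ((s + M).choose M : ℕ) * (s * (s - 1)) := by
  have h1 := Nat.choose_succ_right_eq (s + M) M
  have h2 := Nat.choose_succ_right_eq (s + M) (M + 1)
  rw [show s + M - M = s by omega] at h1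
  have h3 : (((s + M).choose (M + 1 + 1) : ℕ) : ℤ) * (M + 2) =
      ((s + M).choose (M + 1) : ℕ) * (s - 1) := by
    rcases s with _ | s
    · simp [Nat.choose_eq_zero_of_lt (show M < M + 1 + 1 by omega)]
    · rw [show s + 1 + M - (M + 1) = s by omega] at h2
      zify at h2
      push_cast at h2 ⊢
      linear_combination h2
  zify at h1
  calc _ = (((s + M).choose (M + 1 + 1) : ℕ) : ℤ) * (M + 2) * (M + 1) := by ring
    _ = (((s + M).choose (M + 1) : ℕ) * (M + 1)) * (s - 1) := by rw [h3]; ring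
    _ = _ := by rw [h1]; ring

/-- The polynomial identity that turns multiplication by `r² + r + n - 1` into a three-term
combination of binomial coefficients of degree two higher. -/
theorem Int.choose_three_term (n M k r : ℕ) (hM : M + 2 = 2 * n) (hk : k ≤ r) :
    ((r : ℤ) ^ 2 + r + n - 1) * ((r + M - k).choose M : ℕ) =
      ((k : ℤ) ^ 2 + k + n - 1) * ((r + (M + 2) - k).choose (M + 2) : ℕ)
      + 2 * (k * (2 * n - k - 2) + n) * ((r + (M + 2) - (k + 1)).choose (M + 2) : ℕ)
      + ((2 * n - k - 2) * (2 * n - k - 1) + (n - 1)) *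
        ((r + (M + 2) - (k + 2)).choose (M + 2) : ℕ) := by
  obtain ⟨s, rfl⟩ := Nat.exists_eq_add_of_le hk
  rw [show k + s + M - k = s + M by omega, show k + s + (M + 2) - k = s + M + 2 by omega,
    show k + s + (M + 2) - (k + 1) = s + M + 1 by omega,
    show k + s + (M + 2) - (k + 2) = s + M by omega]
  have h0 := Int.choose_shift_zero M s
  have h1 := Int.choose_shift_one M s
  have h2 := Int.choose_shift_two M s
  have hn : (2 * n : ℤ) = M + 2 := by exact_mod_cast hM.symm
  -- Each of the three binomials is C(s+M, M) times a quadratic in s over (M+1)(M+2); clearing this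
  -- denominator leaves a polynomial identity.
  have hne : (2 * ((M + 1) * (M + 2)) : ℤ) ≠ 0 := by positivity
  apply mul_right_cancel₀ hne
  have hM' : (M : ℤ) = 2 * n - 2 := by linarith
  rw [hM'] at h0 h1 h2 ⊢
  push_cast
  linear_combination (-2 * ((k : ℤ) ^ 2 + k + n - 1)) * h2
    - 2 * (2 * (k * (2 * n - k - 2) + n)) * h1
    - 2 * ((2 * n - k - 2) * (2 * n - k - 1) + (n - 1)) * h0

/-- The system is unitriangular: equation r involves only g 0, …, g r, and g r has coefficient C(N,
N) = 1. -/
theorem eq_zero_of_sum_choose_eq_zero (N : ℕ) (g : ℕ → ℤ)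
    (h : ∀ r, ∑ k ∈ Finset.range (r + 1), g k * ((r + N - k).choose N : ℕ) = 0) (k : ℕ) :
    g k = 0 := by
  induction k using Nat.strong_induction_on with
  | _ k ih =>
    have := h k
    rw [Finset.sum_range_succ, Finset.sum_eq_zero] at this
    · simpa using this
    · intro j hj
      rw [ih j (Finset.mem_range.1 hj), zero_mul]

theorem sum_range_shift_two (G : ℕ → ℤ) (r : ℕ) (h0 : G 0 = 0) (h1 : G 1 = 0)
    (h2 : G (r + 1) = 0) (h3 : G (r + 2) = 0) :
    ∑ k ∈ Finset.range (r + 1), G k = ∑ k ∈ Finset.range (r + 1), G (k + 2) := by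
  have e : ∑ k ∈ Finset.range (r + 3), G k = ∑ k ∈ Finset.range (r + 1), G k := by
    rw [Finset.sum_range_succ, Finset.sum_range_succ, h2, h3]; ring
  rw [← e, Finset.sum_range_succ', Finset.sum_range_succ', h0, zero_add, h1]; ring

theorem sum_range_shift_one (G : ℕ → ℤ) (r : ℕ) (h0 : G 0 = 0) (h1 : G (r + 1) = 0) :
    ∑ k ∈ Finset.range (r + 1), G k = ∑ k ∈ Finset.range (r + 1), G (k + 1) := by
  have e : ∑ k ∈ Finset.range (r + 2), G k = ∑ k ∈ Finset.range (r + 1), G k := by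
    rw [Finset.sum_range_succ, h1]; ring
  rw [← e, Finset.sum_range_succ', h0, add_zero]

theorem mul_choose_sub_one (x n : ℕ) (hn : 2 ≤ n) :
    (n : ℤ) * ((x + n - 1).choose n : ℕ) =
      ((x : ℤ) + n - 1) * ((x + (n - 1) - 1).choose (n - 1) : ℕ) := by
  obtain ⟨n, rfl⟩ := Nat.exists_eq_add_of_le' hn
  have h := Nat.add_one_mul_choose_eq (x + n) (n + 1)
  rw [show x + (n + 2) - 1 = x + n + 1 by omega, show x + (n + 2 - 1) - 1 = x + n by omega,
    show n + 2 - 1 = n + 1 by omega]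
  zify at h
  push_cast at h ⊢
  linear_combination -h

/-- Sequences whose generating polynomials have the expansion with coefficients
`C(r² + r + n - 1, n)` satisfy the three-term recurrence. -/
theorem recurrence_of_sum_choose (n : ℕ) (hn : 2 ≤ n) (J J' : ℤ → ℤ)
    (hneg : ∀ k < 0, J' k = 0)
    (hJ : ∀ r : ℕ, ∑ k ∈ Finset.range (r + 1), J k * ((r + 2 * n - k).choose (2 * n) : ℕ) =
      ((r * (r + 1) + n - 1).choose n : ℕ))
    (hJ' : ∀ r : ℕ, ∑ k ∈ Finset.range (r + 1),
      J' k * ((r + (2 * n - 2) - k).choose (2 * n - 2) : ℕ) =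
      ((r * (r + 1) + (n - 1) - 1).choose (n - 1) : ℕ)) (k : ℕ) :
    (n : ℤ) * J k = ((k : ℤ) ^ 2 + k + n - 1) * J' k
      + 2 * ((k - 1) * (2 * n - k - 1) + n) * J' (k - 1)
      + ((2 * n - k) * (2 * n - k + 1) + (n - 1)) * J' (k - 2) := by
  rw [← sub_eq_zero]
  refine eq_zero_of_sum_choose_eq_zero (2 * n) (fun k : ℕ => (n : ℤ) * J k -
    (((k : ℤ) ^ 2 + k + n - 1) * J' k + 2 * ((k - 1) * (2 * n - k - 1) + n) * J' (k - 1)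
      + ((2 * n - k) * (2 * n - k + 1) + (n - 1)) * J' (k - 2))) (fun r => ?_) k
  obtain ⟨M, hM⟩ : ∃ M, M + 2 = 2 * n := ⟨2 * n - 2, by omega⟩
  have hr := hJ r
  have hr' := hJ' r
  rw [show 2 * n - 2 = M by omega] at hr'
  rw [← hM] at hr ⊢
  have hc := mul_choose_sub_one (r * (r + 1)) n hn
  rw [← hr, ← hr'] at hc
  have hz1 : (r + (M + 2) - (r + 1)).choose (M + 2) = 0 := Nat.choose_eq_zero_of_lt (by omega)
  have hz2 : (r + (M + 2) - (r + 2)).choose (M + 2) = 0 := Nat.choose_eq_zero_of_lt (by omega)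
  -- The shifts lose no boundary terms: `J'` vanishes at negative indices, and the binomials vanish
  -- at k = r+1 and k = r+2.
  have s1 := sum_range_shift_one (fun k : ℕ => (2 * ((k - 1) * (2 * n - k - 1) + n) *
    J' (k - 1)) * ((r + (M + 2) - k).choose (M + 2) : ℕ)) r
    (by simp [hneg]) (by simp [hz1])
  have s2 := sum_range_shift_two (fun k : ℕ => (((2 * n - k) * (2 * n - k + 1) + (n - 1)) *
    J' (k - 2)) * ((r + (M + 2) - k).choose (M + 2) : ℕ)) r
    (by simp [hneg]) (by simp [hneg]) (by simp [hz1]) (by simp [hz2])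
  have s3 : ((r : ℤ) * (r + 1) + n - 1) *
      ∑ k ∈ Finset.range (r + 1), J' k * ((r + M - k).choose M : ℕ) =
      ∑ k ∈ Finset.range (r + 1),
        (((k : ℤ) ^ 2 + k + n - 1) * J' k) * ((r + (M + 2) - k).choose (M + 2) : ℕ) +
      ∑ k ∈ Finset.range (r + 1), (2 * (((k + 1 : ℕ) - 1) * (2 * n - (k + 1 : ℕ) - 1) + n) *
        J' ((k + 1 : ℕ) - 1)) * ((r + (M + 2) - (k + 1)).choose (M + 2) : ℕ) +
      ∑ k ∈ Finset.range (r + 1), (((2 * n - (k + 2 : ℕ)) * (2 * n - (k + 2 : ℕ) + 1) + (n - 1)) *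
        J' ((k + 2 : ℕ) - 2)) * ((r + (M + 2) - (k + 2)).choose (M + 2) : ℕ) := by
    rw [← Finset.sum_add_distrib, ← Finset.sum_add_distrib, Finset.mul_sum]
    refine Finset.sum_congr rfl fun k hk => ?_
    have h3 := Int.choose_three_term n M k r hM (by simpa [Nat.lt_succ_iff] using hk)
    have e1 : ((k + 1 : ℕ) : ℤ) - 1 = k := by push_cast; ring
    have e2 : ((k + 2 : ℕ) : ℤ) - 2 = k := by push_cast; ring
    rw [e1, e2]
    push_cast
    linear_combination J' k * h3
  rw [← s1, ← s2] at s3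
  push_cast at hc
  rw [s3, Finset.mul_sum] at hc
  rw [← Finset.sum_add_distrib, ← Finset.sum_add_distrib, ← sub_eq_zero,
    ← Finset.sum_sub_distrib] at hc
  rw [← hc]
  exact Finset.sum_congr rfl fun k _ => by ring

/-! ### Counting increasing integer sequences -/

theorem card_orderEmbedding_fin (N K : ℕ) : Nat.card (Fin N ↪o Fin K) = K.choose N := by
  rw [Nat.card_congr Set.powersetCard.ofFinEmbEquiv, Set.powersetCard.card, Nat.card_fin]

theorem ncard_strictMono_from_zero (N K : ℕ) :
    {A : Fin (N + 1) → ℤ | A 0 = 0 ∧ StrictMono A ∧ ∀ i, A i ≤ K}.ncard = K.choose N := by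
  rw [← card_orderEmbedding_fin, ← Set.ncard_univ]
  symm
  refine Set.ncard_congr
    (fun f _ => Fin.cons (α := fun _ => ℤ) 0 fun i => ((f i : ℕ) : ℤ) + 1) ?_ ?_ ?_
  · intro f _
    refine ⟨rfl, ?_, fun i => ?_⟩
    · intro i j hij
      induction j using Fin.cases with
      | zero => exact absurd hij (Fin.not_lt_zero i)
      | succ j =>
        induction i using Fin.cases with
        | zero => simp only [Fin.cons_zero, Fin.cons_succ]; omega
        | succ i =>
          have : (f i : ℕ) < f j := f.strictMono (Fin.succ_lt_succ_iff.1 hij)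
          simp only [Fin.cons_succ]; omega
    · induction i using Fin.cases with
      | zero => simp
      | succ i => have := (f i).isLt; simp only [Fin.cons_succ]; omega
  · intro f g _ _ h
    ext i
    have := congrFun h i.succ
    simp only [Fin.cons_succ] at this
    omega
  · rintro A ⟨h0, hA, hK⟩
    have hpos : ∀ i : Fin N, 0 < A i.succ := fun i => h0 ▸ hA (Fin.succ_pos i)
    refine ⟨OrderEmbedding.ofStrictMono (fun i => ⟨(A i.succ - 1).toNat, ?_⟩) ?_, trivial, ?_⟩
    · have := hpos i; have := hK i.succ; omega
    · intro i j hij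
      have h1 := hpos i
      have h2 : A i.succ < A j.succ := hA (Fin.succ_lt_succ_iff.2 hij)
      change (A i.succ - 1).toNat < (A j.succ - 1).toNat
      omega
    · funext i
      induction i using Fin.cases with
      | zero => simp [h0]
      | succ i =>
        have := hpos i
        change (((A i.succ - 1).toNat : ℕ) : ℤ) + 1 = A i.succ
        omega

/-- The number of weakly increasing sequences `0 = B 0 ≤ B 1 ≤ ⋯ ≤ B N ≤ r` that increase strictly
at the positions in `D`. -/
theorem ncard_monotone_strict_at (N r : ℕ) (D : Finset (Fin N)) :
    {B : Fin (N + 1) → ℤ | B 0 = 0 ∧ (∀ i : Fin N, B i.castSucc ≤ B i.succ) ∧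
      (∀ i ∈ D, B i.castSucc < B i.succ) ∧ B (Fin.last N) ≤ r}.ncard =
      (r + N - D.card).choose N := by
  have hD : D.card ≤ N := by simpa using D.card_le_univ
  -- `s i` counts the positions before `i` where equality is allowed. Adding it makes every step
  -- strict and raises the upper bound to r + N - |D|.
  let s : Fin (N + 1) → ℕ := fun i => (Dᶜ.filter fun j => j.castSucc < i).card
  have s0 : s 0 = 0 := by simp [s]
  have slast : s (Fin.last N) = N - D.card := by
    simp [s, Fin.castSucc_lt_last, Finset.card_compl]
  have ssucc : ∀ i : Fin N, s i.succ = s i.castSucc + if i ∈ D then 0 else 1 := by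
    intro i
    have : (Dᶜ.filter fun j => j.castSucc < i.succ) =
        (Dᶜ.filter fun j => j.castSucc < i.castSucc) ∪ (if i ∈ D then ∅ else {i}) := by
      ext j
      split_ifs with h <;>
        simp only [Finset.mem_filter, Finset.mem_union, Finset.mem_compl, Fin.lt_def,
          Fin.val_castSucc, Fin.val_succ, Finset.notMem_empty, Finset.mem_singleton, Fin.ext_iff]
      · constructor
        · rintro ⟨h1, h2⟩
          refine Or.inl ⟨h1, lt_of_le_of_ne (by omega) fun h3 => h1 (Fin.ext h3 ▸ h)⟩
        · rintro (⟨h1, h2⟩ | h)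
          · exact ⟨h1, by omega⟩
          · exact h.elim
      · constructor
        · rintro ⟨h1, h2⟩
          by_cases h3 : (j : ℕ) = i
          · exact Or.inr h3
          · exact Or.inl ⟨h1, by omega⟩
        · rintro (⟨h1, h2⟩ | h3)
          · exact ⟨h1, by omega⟩
          · exact ⟨Fin.ext h3 ▸ h, by omega⟩
    simp only [s, this]
    rw [Finset.card_union_of_disjoint]
    · split_ifs <;> simp
    · split_ifs <;> simp
  rw [← ncard_strictMono_from_zero]
  refine Set.ncard_congr (fun B _ i => B i + s i) ?_ ?_ ?_
  · rintro B ⟨h0, h1, h2, h3⟩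
    have hs : StrictMono fun i => B i + s i := by
      refine Fin.strictMono_iff_lt_succ.2 fun i => ?_
      have := h1 i
      have := h2 i
      have := ssucc i
      split_ifs at this with h
      · have := h2 i h
        omega
      · omega
    refine ⟨by simp [h0, s0], hs, fun i => ?_⟩
    have := hs.monotone (Fin.le_last i)
    simp only [slast] at this ⊢
    omega
  · intro B B' _ _ h
    funext i
    have := congrFun h i
    simpa using this
  · rintro A ⟨h0, h1, h2⟩
    refine ⟨fun i => A i - s i, ⟨by simp [h0, s0], fun i => ?_, fun i hi => ?_, ?_⟩, ?_⟩
    · have := h1 (Fin.castSucc_lt_succ (i := i))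
      have := ssucc i
      simp only
      split_ifs at this <;> omega
    · have := h1 (Fin.castSucc_lt_succ (i := i))
      have := ssucc i
      rw [if_pos hi] at this
      simp only
      omega
    · have := h2 (Fin.last N)
      simp only [slast]
      omega
    · funext i; simp

/-! ### Signed permutations and compatible labellings -/

namespace SignedSet

@[simp] theorem coe_neg {N : ℕ} (x : SignedSet N) : ((-x : SignedSet N) : ℤ) = -(x : ℤ) := rfl

theorem neg_neg {N : ℕ} (x : SignedSet N) : - -x = x := Subtype.ext (by simp)

theorem neg_lt_neg_iff {N : ℕ} (x y : SignedSet N) : -x < -y ↔ y < x := by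
  rw [← Subtype.coe_lt_coe, ← Subtype.coe_lt_coe]; simp

end SignedSet

namespace SignedPerm

variable {N : ℕ}

@[simp] theorem coe_pos (i : Fin (N + 1)) : ((pos i : SignedSet N) : ℤ) = (i : ℕ) := rfl

theorem neg_pos_zero : -(pos 0 : SignedSet N) = pos 0 := Subtype.ext (by simp)

theorem eq_pos_or_eq_neg_pos (x : SignedSet N) :
    x = pos ⟨(x : ℤ).natAbs, by have := Finset.mem_Icc.1 x.2; omega⟩ ∨
      x = -pos ⟨(x : ℤ).natAbs, by have := Finset.mem_Icc.1 x.2; omega⟩ := by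
  rcases le_total 0 (x : ℤ) with h | h
  · left; apply Subtype.ext; simp only [coe_pos]; omega
  · right; apply Subtype.ext; simp only [coe_pos, SignedSet.coe_neg]; omega

theorem apply_neg (π : SignedPerm N) (x : SignedSet N) : π.1 (-x) = -π.1 x := π.2 x

theorem apply_pos_zero (π : SignedPerm N) : π.1 (pos 0) = pos 0 := by
  have h := apply_neg π (pos 0)
  rw [neg_pos_zero] at h
  have := congrArg Subtype.val h
  apply Subtype.ext
  simp only [SignedSet.coe_neg, coe_pos] at this ⊢
  simp only [Fin.val_zero]
  omega

theorem strictMono_of_pos {L : Type*} [Preorder L] (f : SignedSet N → L)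
    (hneg : ∀ x y, f x < f y → f (-y) < f (-x))
    (hpos : ∀ i : Fin N, f (pos i.castSucc) < f (pos i.succ)) : StrictMono f := by
  have hp : StrictMono fun i : Fin (N + 1) => f (pos i) := Fin.strictMono_iff_lt_succ.2 hpos
  have h1 : ∀ x y : SignedSet N, 0 ≤ (x : ℤ) → x < y → f x < f y := by
    intro x y hx hxy
    have hxy' : (x : ℤ) < y := hxy
    have hx2 := Finset.mem_Icc.1 x.2
    have hy2 := Finset.mem_Icc.1 y.2
    have ex : x = pos ⟨(x : ℤ).natAbs, by omega⟩ := Subtype.ext (by simp only [coe_pos]; omega)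
    have ey : y = pos ⟨(y : ℤ).natAbs, by omega⟩ := Subtype.ext (by simp only [coe_pos]; omega)
    rw [ex, ey]
    exact hp (by simp only [Fin.lt_def]; omega)
  have h2 : ∀ x y : SignedSet N, (y : ℤ) ≤ 0 → x < y → f x < f y := by
    intro x y hy hxy
    have := hneg _ _ (h1 (-y) (-x) (by simpa using hy) ((SignedSet.neg_lt_neg_iff _ _).2 hxy))
    rwa [SignedSet.neg_neg, SignedSet.neg_neg] at this
  intro x y hxy
  rcases le_or_gt 0 (x : ℤ) with hx | hx
  · exact h1 x y hx hxy
  · rcases le_or_gt (y : ℤ) 0 with hy | hy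
    · exact h2 x y hy hxy
    · exact (h2 x (pos 0) (by simp) hx).trans (h1 (pos 0) y (by simp) hy)

/-- Odd labellings `a` of `Ω_N` by integers in `[-r, r]` that are compatible with `π`: weakly
increasing, with `π` increasing on each fibre. -/
def Compatible (π : SignedPerm N) (r : ℕ) (a : SignedSet N → ℤ) : Prop :=
  (∀ x, a (-x) = -a x) ∧ (StrictMono fun x => toLex (a x, π.1 x)) ∧ ∀ x, a x ≤ r

/-- Oddness forces a(0) = 0 and reduces `a` to its values at 0, …, N. Lexicographic monotonicity
need only be tested on consecutive elements there, where it demands a strict increase exactly at the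
descents. -/
theorem ncard_compatible (π : SignedPerm N) (r : ℕ) :
    {a | Compatible π r a}.ncard = (r + N - des π).choose N := by
  rw [des, ← ncard_monotone_strict_at]
  refine Set.ncard_congr (fun a _ i => a (pos i)) ?_ ?_ ?_
  · rintro a ⟨h1, h2, h3⟩
    have hlt : ∀ i : Fin N, a (pos i.castSucc) < a (pos i.succ) ∨
        a (pos i.castSucc) = a (pos i.succ) ∧ π.1 (pos i.castSucc) < π.1 (pos i.succ) := by
      intro i
      have := @h2 (pos i.castSucc) (pos i.succ) (by rw [← Subtype.coe_lt_coe]; simp)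
      simpa [Prod.Lex.toLex_lt_toLex] using this
    refine ⟨?_, fun i => ?_, fun i hi => ?_, h3 _⟩
    · have := h1 (pos 0)
      rw [neg_pos_zero] at this
      simp only
      omega
    · rcases hlt i with h | h
      · exact h.le
      · exact h.1.le
    · rcases hlt i with h | h
      · exact h
      · have := (Finset.mem_filter.1 hi).2
        exact absurd h.2 (not_lt.2 (le_of_lt this))
  · intro a b ha hb hab
    funext x
    rcases eq_pos_or_eq_neg_pos x with h | h <;> rw [h]
    · exact congrFun hab _
    · rw [ha.1, hb.1]; exact congrArg _ (congrFun hab _)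
  · rintro B ⟨h0, h1, h2, h3⟩
    let idx : SignedSet N → Fin (N + 1) := fun x =>
      ⟨(x : ℤ).natAbs, by have := Finset.mem_Icc.1 x.2; omega⟩
    have hidx : ∀ i, idx (pos i) = i := fun i => Fin.ext (by simp [idx])
    have hidxn : ∀ x, idx (-x) = idx x := fun x => Fin.ext (by simp [idx])
    have hmono : Monotone B := Fin.monotone_iff_le_succ.2 h1
    let a : SignedSet N → ℤ := fun x => if 0 ≤ (x : ℤ) then B (idx x) else -B (idx x)
    have hodd : ∀ x, a (-x) = -a x := by
      intro x
      simp only [a, hidxn, SignedSet.coe_neg]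
      rcases lt_trichotomy (x : ℤ) 0 with h | h | h
      · rw [if_pos (by omega), if_neg (by omega), _root_.neg_neg]
      · have : idx x = 0 := Fin.ext (by simp [idx, h])
        simp [h, this, h0]
      · rw [if_neg (by omega), if_pos (by omega)]
    have hapos : ∀ i, a (pos i) = B i := fun i => by simp [a, hidx]
    refine ⟨a, ⟨hodd, ?_, fun x => ?_⟩, funext hapos⟩
    · apply strictMono_of_pos
      · intro x y hxy
        rw [Prod.Lex.toLex_lt_toLex] at hxy ⊢
        simp only [hodd, apply_neg, SignedSet.neg_lt_neg_iff]
        simp only at hxy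
        rcases hxy with h | h
        · left; omega
        · right; exact ⟨by omega, h.2⟩
      · intro i
        rw [Prod.Lex.toLex_lt_toLex]
        simp only [hapos]
        by_cases hi : i ∈ descentSet π
        · exact Or.inl (h2 i hi)
        · rcases (h1 i).lt_or_eq with h | h
          · exact Or.inl h
          · refine Or.inr ⟨h, lt_of_le_of_ne ?_ ?_⟩
            · simpa [descentSet] using hi
            · intro he
              have := congrArg Subtype.val (π.1.injective he)
              simp at this
    · have hl : B (idx x) ≤ r := (hmono (Fin.le_last _)).trans h3
      have hz : 0 ≤ B (idx x) := h0 ▸ hmono (Fin.zero_le _)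
      simp only [a]
      split_ifs <;> omega

end SignedPerm

/-! ### Symmetric multiplicity matrices and their fundamental domain -/

namespace SignedPerm

open Finset

/-- The square `[-r, r]²`. -/
noncomputable def square (r : ℕ) : Finset (ℤ × ℤ) := Icc (-(r : ℤ)) r ×ˢ Icc (-(r : ℤ)) r

/-- Representatives of the nontrivial orbits of `(c, d) ↦ (d, c)` and `(c, d) ↦ (-c, -d)` on the
square off the diagonal. -/
noncomputable def wedge (r : ℕ) : Finset (ℤ × ℤ) := (square r).filter fun p => -p.1 ≤ p.2 ∧ p.2 < p.1

theorem mem_square {r : ℕ} {p : ℤ × ℤ} :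
    p ∈ square r ↔ (-(r : ℤ) ≤ p.1 ∧ p.1 ≤ r) ∧ -(r : ℤ) ≤ p.2 ∧ p.2 ≤ r := by
  simp [square]

theorem mem_wedge {r : ℕ} {p : ℤ × ℤ} : p ∈ wedge r ↔ p.1 ≤ r ∧ -p.1 ≤ p.2 ∧ p.2 < p.1 := by
  simp only [wedge, mem_filter, mem_square]
  omega

theorem card_wedge (r : ℕ) : (wedge r).card = r * (r + 1) := by
  rw [card_eq_sum_card_fiberwise (f := fun p : ℤ × ℤ => p.1.toNat - 1) (t := range r)]
  · have : ∀ i ∈ range r, ((wedge r).filter fun p => p.1.toNat - 1 = i).card = (i + 1) * 2 := by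
      intro i hi
      have hi := mem_range.1 hi
      have : ((wedge r).filter fun p => p.1.toNat - 1 = i) =
          {((i : ℤ) + 1)} ×ˢ Ico (-((i : ℤ) + 1)) (i + 1) := by
        ext p
        simp only [mem_filter, mem_wedge, mem_product, mem_singleton, mem_Ico]
        omega
      rw [this, card_product, card_singleton, Int.card_Ico]
      omega
    rw [sum_congr rfl this, ← sum_mul]
    clear this
    induction r with
    | zero => simp
    | succ r ih => rw [sum_range_succ, add_mul, ih]; ring
  · intro p hp
    have := mem_wedge.1 (mem_coe.1 hp)
    simp only [coe_range, Set.mem_Iio]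
    omega

/-- The symmetric multiplicity function on the square generated by multiplicities on the wedge. -/
noncomputable def symmetrize (m : ℤ × ℤ → ℕ) (p : ℤ × ℤ) : ℕ :=
  (if p = (0, 0) then 1 else 0) + m (p.1, p.2) + m (p.2, p.1) + m (-p.1, -p.2) + m (-p.2, -p.1)

/-- The multiplicities on the wedge that generate a symmetric multiplicity function. -/
noncomputable def fold (r : ℕ) (M : ℤ × ℤ → ℕ) (p : ℤ × ℤ) : ℕ :=
  if p ∈ wedge r then (if p.1 + p.2 = 0 then M p / 2 else M p) else 0

/-- A generic orbit has four points, exactly one of them in the wedge. An antidiagonal orbit has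
only two, so `symmetrize` hits each twice; hence the halving in `fold` and the evenness hypothesis.
-/
theorem symmetrize_fold (r : ℕ) (M : ℤ × ℤ → ℕ) (hswap : ∀ c d, M (d, c) = M (c, d))
    (hneg : ∀ c d, M (-c, -d) = M (c, d)) (h0 : M (0, 0) = 1) (hdiag : ∀ c, c ≠ 0 → M (c, c) = 0)
    (heven : ∀ c, c ≠ 0 → Even (M (c, -c))) (hsq : ∀ p, p ∉ square r → M p = 0) (p : ℤ × ℤ) :
    symmetrize (fold r M) p = M p := by
  obtain ⟨c, d⟩ := p
  simp only [symmetrize, fold, hneg, hswap c d, mem_wedge, Prod.mk.injEq]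
  by_cases hin : (c, d) ∈ square r
  swap
  · have h := hsq _ hin
    have : ¬(c = 0 ∧ d = 0) := by
      rintro ⟨rfl, rfl⟩
      simp [mem_square] at hin
    rw [h]
    simp [this]
  rw [mem_square] at hin
  simp only at hin
  by_cases hcd : c = d
  · subst hcd
    by_cases hc : c = 0
    · subst hc; simp [h0]
    · simp [hc, hdiag c hc]
  by_cases hanti : d = -c
  · subst hanti
    obtain ⟨q, hq⟩ := heven c (by omega)
    rw [hq]
    split_ifs <;> omega
  · split_ifs <;> omega

theorem fold_symmetrize (r : ℕ) (m : ℤ × ℤ → ℕ) (hm : ∀ p, p ∉ wedge r → m p = 0) (p : ℤ × ℤ) :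
    fold r (symmetrize m) p = m p := by
  obtain ⟨c, d⟩ := p
  simp only [fold]
  split_ifs with h1 h2
  · rw [mem_wedge] at h1
    simp only at h1 h2
    obtain rfl : d = -c := by omega
    have e1 : m (-c, c) = 0 := hm _ (by rw [mem_wedge]; simp only; omega)
    have e0 : ¬((c, -c) = ((0, 0) : ℤ × ℤ)) := by rw [Prod.mk.injEq]; omega
    simp only [symmetrize, e0, _root_.neg_neg, e1, if_false]
    omega
  · rw [mem_wedge] at h1
    simp only at h1 h2
    have e1 : m (d, c) = 0 := hm _ (by rw [mem_wedge]; simp only; omega)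
    have e2 : m (-c, -d) = 0 := hm _ (by rw [mem_wedge]; simp only; omega)
    have e3 : m (-d, -c) = 0 := hm _ (by rw [mem_wedge]; simp only; omega)
    have e0 : ¬((c, d) = ((0, 0) : ℤ × ℤ)) := by rw [Prod.mk.injEq]; omega
    simp only [symmetrize, e0, e1, e2, e3, if_false]
    omega
  · exact (hm _ h1).symm

theorem symmetrize_eq_zero (r : ℕ) (m : ℤ × ℤ → ℕ) (hm : ∀ p, p ∉ wedge r → m p = 0) (p : ℤ × ℤ)
    (hp : p ∉ square r) : symmetrize m p = 0 := by
  rw [mem_square] at hp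
  have e0 : ¬(p = (0, 0)) := by rintro rfl; simp at hp
  have e1 : m (p.1, p.2) = 0 := hm _ (by rw [mem_wedge]; simp only; omega)
  have e2 : m (p.2, p.1) = 0 := hm _ (by rw [mem_wedge]; simp only; omega)
  have e3 : m (-p.1, -p.2) = 0 := hm _ (by rw [mem_wedge]; simp only; omega)
  have e4 : m (-p.2, -p.1) = 0 := hm _ (by rw [mem_wedge]; simp only; omega)
  simp [symmetrize, e0, e1, e2, e3, e4]

theorem sum_symmetrize (r : ℕ) (m : ℤ × ℤ → ℕ) (hm : ∀ p, p ∉ wedge r → m p = 0) :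
    ∑ p ∈ square r, symmetrize m p = 1 + 4 * ∑ p ∈ wedge r, m p := by
  have h1 : ∑ p ∈ square r, m (p.1, p.2) = ∑ p ∈ wedge r, m p :=
    (sum_subset (filter_subset _ _) fun p _ hp => hm p hp).symm
  have h2 : ∑ p ∈ square r, m (p.2, p.1) = ∑ p ∈ square r, m (p.1, p.2) :=
    sum_nbij' (fun p => (p.2, p.1)) (fun p => (p.2, p.1))
      (fun p hp => by rw [mem_square] at *; simp only; omega)
      (fun p hp => by rw [mem_square] at *; simp only; omega) (by simp) (by simp) (by simp)
  have h3 : ∑ p ∈ square r, m (-p.1, -p.2) = ∑ p ∈ square r, m (p.1, p.2) :=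
    sum_nbij' (fun p => (-p.1, -p.2)) (fun p => (-p.1, -p.2))
      (fun p hp => by rw [mem_square] at *; simp only; omega)
      (fun p hp => by rw [mem_square] at *; simp only; omega) (by simp) (by simp) (by simp)
  have h4 : ∑ p ∈ square r, m (-p.2, -p.1) = ∑ p ∈ square r, m (p.1, p.2) :=
    sum_nbij' (fun p => (-p.2, -p.1)) (fun p => (-p.2, -p.1))
      (fun p hp => by rw [mem_square] at *; simp only; omega)
      (fun p hp => by rw [mem_square] at *; simp only; omega) (by simp) (by simp) (by simp)
  have h5 : ∑ p ∈ square r, (if p = ((0, 0) : ℤ × ℤ) then 1 else 0) = 1 := by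
    rw [sum_ite_eq', if_pos]
    simp [mem_square]
  simp only [symmetrize, sum_add_distrib, h2, h3, h4, h5, h1]
  ring

/-- The lexicographically ordered set of triples `(c, d, k)` with `k < M (c, d)`. -/
noncomputable def multiplicitySet (r : ℕ) (M : ℤ × ℤ → ℕ) : Finset (ℤ ×ₗ ℤ ×ₗ ℕ) :=
  ((square r).sigma fun p => range (M p)).image fun s => toLex (s.1.1, toLex (s.1.2, s.2))

theorem mem_multiplicitySet {r : ℕ} {M : ℤ × ℤ → ℕ} {c d : ℤ} {k : ℕ} :
    toLex (c, toLex (d, k)) ∈ multiplicitySet r M ↔ (c, d) ∈ square r ∧ k < M (c, d) := by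
  simp only [multiplicitySet, mem_image, mem_sigma, mem_range]
  constructor
  · rintro ⟨⟨⟨c', d'⟩, k'⟩, h, he⟩
    simp only [EmbeddingLike.apply_eq_iff_eq, Prod.mk.injEq] at he
    obtain ⟨rfl, rfl, rfl⟩ := he
    exact h
  · intro h
    exact ⟨⟨(c, d), k⟩, h, rfl⟩

theorem card_multiplicitySet (r : ℕ) (M : ℤ × ℤ → ℕ) :
    (multiplicitySet r M).card = ∑ p ∈ square r, M p := by
  rw [multiplicitySet, card_image_of_injective, card_sigma]
  · simp
  · rintro ⟨⟨c, d⟩, k⟩ ⟨⟨c', d'⟩, k'⟩ he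
    simp only [EmbeddingLike.apply_eq_iff_eq, Prod.mk.injEq] at he
    obtain ⟨rfl, rfl, rfl⟩ := he
    rfl

/-- A finite chain has only one increasing enumeration. This gives both the uniqueness of π and its
compatibility with negation. -/
theorem eq_of_strictMono_of_mem {α β : Type*} [LinearOrder α] [Fintype α] [LinearOrder β]
    (s : Finset β) (hs : s.card = Fintype.card α) (f g : α → β) (hf : StrictMono f)
    (hg : StrictMono g) (hfs : ∀ x, f x ∈ s) (hgs : ∀ x, g x ∈ s) : f = g := by
  have key : ∀ h : α → β, StrictMono h → (∀ x, h x ∈ s) → Set.range h = s := by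
    intro h hh hhs
    have : univ.image h = s := by
      apply eq_of_subset_of_card_le
      · intro y hy
        obtain ⟨x, -, rfl⟩ := mem_image.1 hy
        exact hhs x
      · rw [card_image_of_injective _ hh.injective, card_univ, hs]
    rw [← this]; simp
  exact (StrictMono.range_inj hf hg).1 ((key f hf hfs).trans (key g hg hgs).symm)

theorem card_signedSet (N : ℕ) : Fintype.card (SignedSet N) = 2 * N + 1 := by
  rw [Fintype.card_coe, Int.card_Icc]; omega

end SignedPerm

/-! ### The matrix of a pair (π, a) and its injectivity -/

namespace SignedPerm

open Finset

variable {N : ℕ}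

theorem IsFixedPointFreeInvolution.apply_apply {π : SignedPerm N}
    (h : IsFixedPointFreeInvolution π) (x : SignedSet N) : π.1 (π.1 x) = x := by
  have h1 : π.1⁻¹ = π.1 := congrArg Subtype.val h.1
  have h2 : π.1⁻¹ x = π.1 x := by rw [h1]
  rw [← h2]
  exact π.1.apply_symm_apply x

theorem isFixedPointFreeInvolution_iff {π : SignedPerm N} :
    IsFixedPointFreeInvolution π ↔ (∀ x, π.1 (π.1 x) = x) ∧
      ∀ x, x ≠ pos 0 → π.1 x ≠ x ∧ π.1 x ≠ -x := by
  constructor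
  · intro h
    refine ⟨h.apply_apply, fun x hx => ?_⟩
    have key : ∀ i : Fin (N + 1), i ≠ 0 → π.1 (pos i) ≠ pos i ∧ π.1 (pos i) ≠ -pos i := by
      intro i hi
      obtain ⟨j, rfl⟩ := Fin.exists_succ_eq.2 hi
      exact h.2 j
    rcases eq_pos_or_eq_neg_pos x with e | e
    · rw [e]
      refine key _ fun h0 => hx ?_
      rw [e, h0]
    · rw [e, apply_neg, SignedSet.neg_neg]
      have := key ⟨(x : ℤ).natAbs, by have := Finset.mem_Icc.1 x.2; omega⟩
        fun h0 => hx (by rw [e, h0, neg_pos_zero])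
      refine ⟨fun he => this.1 ?_, fun he => this.2 ?_⟩
      · rw [← SignedSet.neg_neg (π.1 _), he, SignedSet.neg_neg]
      · rw [← SignedSet.neg_neg (π.1 _), he]
  · rintro ⟨h1, h2⟩
    refine ⟨?_, fun i => h2 _ fun h0 => ?_⟩
    · apply Subtype.ext
      ext1 x
      change π.1.symm x = π.1 x
      rw [Equiv.symm_apply_eq, h1]
    · have := congrArg Subtype.val h0
      simp at this
      omega

/-- The number of `x` with label `c` whose image has label `d`. -/
noncomputable def multiplicity (π : SignedPerm N) (a : SignedSet N → ℤ) (p : ℤ × ℤ) : ℕ :=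
  (univ.filter fun x => a x = p.1 ∧ a (π.1 x) = p.2).card

theorem Compatible.monotone {π : SignedPerm N} {r : ℕ} {a : SignedSet N → ℤ}
    (h : Compatible π r a) : Monotone a := by
  refine monotone_iff_forall_lt.2 fun x y hxy => ?_
  rcases Prod.Lex.toLex_lt_toLex.1 (h.2.1 hxy) with h | h
  · exact h.le
  · exact h.1.le

theorem Compatible.lt_iff_lt {π : SignedPerm N} {r : ℕ} {a : SignedSet N → ℤ}
    (h : Compatible π r a) {x y : SignedSet N} (hxy : a x = a y) : π.1 x < π.1 y ↔ x < y := by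
  have := h.2.1.lt_iff_lt (a := x) (b := y)
  rw [Prod.Lex.toLex_lt_toLex] at this
  simpa [hxy] using this

theorem Compatible.mem_square {π : SignedPerm N} {r : ℕ} {a : SignedSet N → ℤ}
    (h : Compatible π r a) (x y : SignedSet N) : (a x, a y) ∈ square r := by
  have h1 := h.2.2 x
  have h2 := h.2.2 y
  have h3 := h.2.2 (-x)
  have h4 := h.2.2 (-y)
  rw [h.1] at h3 h4
  rw [SignedPerm.mem_square]
  simp only
  omega

section Multiplicity

variable {π : SignedPerm N} {r : ℕ} {a : SignedSet N → ℤ}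

theorem multiplicity_swap (h : IsFixedPointFreeInvolution π) (c d : ℤ) :
    multiplicity π a (d, c) = multiplicity π a (c, d) := by
  refine card_nbij' π.1 π.1 ?_ ?_ ?_ ?_ <;> intro x hx
  · simpa [h.apply_apply, and_comm] using hx
  · simpa [h.apply_apply, and_comm] using hx
  · exact h.apply_apply x
  · exact h.apply_apply x

theorem multiplicity_neg (ha : Compatible π r a) (c d : ℤ) :
    multiplicity π a (-c, -d) = multiplicity π a (c, d) := by
  refine card_nbij' (fun x => -x) (fun x => -x) ?_ ?_ ?_ ?_ <;> intro x hx
  · have hx' := (mem_filter.1 hx).2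
    simp only [coe_filter, Set.mem_ofPred_eq, ha.1, apply_neg, mem_univ, true_and]
    simp only at hx'
    omega
  · have hx' := (mem_filter.1 hx).2
    simp only [coe_filter, Set.mem_ofPred_eq, ha.1, apply_neg, mem_univ, true_and]
    simp only at hx'
    omega
  · exact SignedSet.neg_neg x
  · exact SignedSet.neg_neg x

/-- As π increases on fibres, π x < x would be equivalent to x = π (π x) > π x reversed, that is, to
x < π x. -/
theorem apply_eq_of_label_eq (h : IsFixedPointFreeInvolution π) (ha : Compatible π r a)
    (x : SignedSet N) (hx : a (π.1 x) = a x) : π.1 x = x := by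
  have h1 := ha.lt_iff_lt hx
  have h2 := ha.lt_iff_lt hx.symm
  rw [h.apply_apply] at h1 h2
  rcases lt_trichotomy (π.1 x) x with h3 | h3 | h3
  · exact absurd h3 (h1.2 h3).asymm
  · exact h3
  · exact absurd h3 (h2.2 h3).asymm

theorem Compatible.label_zero (ha : Compatible π r a) : a (pos 0) = 0 := by
  have := ha.1 (pos 0)
  rw [neg_pos_zero] at this
  omega

theorem multiplicity_diag (h : IsFixedPointFreeInvolution π) (ha : Compatible π r a) (c : ℤ)
    (hc : c ≠ 0) : multiplicity π a (c, c) = 0 := by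
  rw [multiplicity, card_eq_zero, filter_eq_empty_iff]
  rintro x - ⟨h1, h2⟩
  have h3 := apply_eq_of_label_eq h ha x (h2.trans h1.symm)
  refine ((isFixedPointFreeInvolution_iff.1 h).2 x ?_).1 h3
  rintro rfl
  exact hc (h1.symm.trans ha.label_zero)

theorem multiplicity_zero (h : IsFixedPointFreeInvolution π) (ha : Compatible π r a) :
    multiplicity π a (0, 0) = 1 := by
  rw [multiplicity, card_eq_one]
  refine ⟨pos 0, ?_⟩
  ext x
  simp only [mem_filter, mem_univ, true_and, mem_singleton]
  constructor
  · rintro ⟨h1, h2⟩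
    by_contra hx
    exact ((isFixedPointFreeInvolution_iff.1 h).2 x hx).1
      (apply_eq_of_label_eq h ha x (h2.trans h1.symm))
  · rintro rfl
    rw [apply_pos_zero, ha.label_zero]
    simp

/-- The map x ↦ -π x is an involution of this set, without fixed points because π x ≠ -x; so its
cardinality vanishes in `ZMod 2`. -/
theorem even_multiplicity (h : IsFixedPointFreeInvolution π) (ha : Compatible π r a) (c : ℤ)
    (hc : c ≠ 0) : Even (multiplicity π a (c, -c)) := by
  have h0 : ((∑ x ∈ univ.filter fun x => a x = c ∧ a (π.1 x) = -c, (1 : ZMod 2))) = 0 := by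
    refine sum_involution (fun x _ => -π.1 x) (fun _ _ => by decide) ?_ ?_ ?_
    · rintro x hx - he
      have hx' := (mem_filter.1 hx).2
      refine ((isFixedPointFreeInvolution_iff.1 h).2 x ?_).2 ?_
      · rintro rfl
        exact hc (hx'.1.symm.trans ha.label_zero)
      · rw [← SignedSet.neg_neg (π.1 x), he]
    · intro x hx
      have hx' := (mem_filter.1 hx).2
      simp only [mem_filter, mem_univ, true_and, ha.1, apply_neg, h.apply_apply]
      omega
    · intro x hx
      rw [apply_neg, h.apply_apply, SignedSet.neg_neg]
  rw [sum_const, nsmul_one] at h0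
  exact (ZMod.natCast_eq_zero_iff_even).1 h0

theorem multiplicity_eq_zero (ha : Compatible π r a) (p : ℤ × ℤ) (hp : p ∉ square r) :
    multiplicity π a p = 0 := by
  rw [multiplicity, card_eq_zero, filter_eq_empty_iff]
  rintro x - ⟨h1, h2⟩
  apply hp
  have := ha.mem_square x (π.1 x)
  rwa [h1, h2] at this

theorem symmetrize_fold_multiplicity (h : IsFixedPointFreeInvolution π) (ha : Compatible π r a) :
    symmetrize (fold r (multiplicity π a)) = multiplicity π a :=
  funext <| symmetrize_fold r _ (multiplicity_swap h) (multiplicity_neg ha) (multiplicity_zero h ha)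
    (multiplicity_diag h ha) (even_multiplicity h ha) (multiplicity_eq_zero ha)

theorem sum_multiplicity (ha : Compatible π r a) :
    ∑ p ∈ square r, multiplicity π a p = 2 * N + 1 := by
  rw [← card_signedSet, ← card_univ,
    card_eq_sum_card_fiberwise (f := fun x => (a x, a (π.1 x))) (t := square r)
      fun x _ => ha.mem_square _ _]
  refine sum_congr rfl fun p _ => ?_
  simp only [multiplicity, Prod.ext_iff]

/-- The position of `x` among the elements whose labels agree with those of `x`. -/
noncomputable def rank (π : SignedPerm N) (a : SignedSet N → ℤ) (x : SignedSet N) : ℕ :=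
  (univ.filter fun y => y < x ∧ a y = a x ∧ a (π.1 y) = a (π.1 x)).card

/-- The triple that encodes `x`: its label, the label of its image, and its rank. -/
noncomputable def code (π : SignedPerm N) (a : SignedSet N → ℤ) (x : SignedSet N) :
    ℤ ×ₗ ℤ ×ₗ ℕ := toLex (a x, toLex (a (π.1 x), rank π a x))

/-- Since π increases on fibres, it maps the cell (c, d) increasingly onto the cell (d, c). -/
theorem rank_apply (h : IsFixedPointFreeInvolution π) (ha : Compatible π r a) (x : SignedSet N) :
    rank π a (π.1 x) = rank π a x := by
  refine card_nbij' π.1 π.1 ?_ ?_ ?_ ?_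
  · intro y hy
    have hy' := (mem_filter.1 hy).2
    rw [h.apply_apply] at hy'
    simp only [coe_filter, Set.mem_ofPred_eq, mem_univ, true_and, h.apply_apply]
    refine ⟨?_, hy'.2.2, hy'.2.1⟩
    rw [← ha.lt_iff_lt hy'.2.2, h.apply_apply]
    exact hy'.1
  · intro y hy
    have hy' := (mem_filter.1 hy).2
    simp only [coe_filter, Set.mem_ofPred_eq, mem_univ, true_and, h.apply_apply]
    exact ⟨(ha.lt_iff_lt hy'.2.1).2 hy'.1, hy'.2.2, hy'.2.1⟩
  · exact fun y _ => h.apply_apply y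
  · exact fun y _ => h.apply_apply y

theorem code_strictMono (ha : Compatible π r a) : StrictMono (code π a) := by
  intro x y hxy
  rw [code, code, Prod.Lex.toLex_lt_toLex]
  rcases (ha.monotone hxy.le).lt_or_eq with h1 | h1
  · exact Or.inl h1
  refine Or.inr ⟨h1, Prod.Lex.toLex_lt_toLex.2 ?_⟩
  rcases (ha.monotone ((ha.lt_iff_lt h1).2 hxy).le).lt_or_eq with h2 | h2
  · exact Or.inl h2
  have hr : rank π a x < rank π a y := by
    apply card_lt_card
    rw [ssubset_iff_of_subset]
    · exact ⟨x, by simp [hxy, h1, h2], by simp⟩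
    · intro z hz
      have hz' := (mem_filter.1 hz).2
      exact mem_filter.2 ⟨mem_univ _, hz'.1.trans hxy, hz'.2.1.trans h1, hz'.2.2.trans h2⟩
  exact Or.inr ⟨h2, hr⟩

theorem code_mem (ha : Compatible π r a) (x : SignedSet N) :
    code π a x ∈ multiplicitySet r (multiplicity π a) := by
  rw [code, mem_multiplicitySet]
  refine ⟨ha.mem_square _ _, card_lt_card ?_⟩
  rw [ssubset_iff_of_subset]
  · exact ⟨x, by simp, by simp⟩
  · intro z hz
    have hz' := (mem_filter.1 hz).2
    exact mem_filter.2 ⟨mem_univ _, hz'.2⟩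

end Multiplicity

/-- Both codes enumerate the same chain, so they coincide; π is then read off as the exchange of the
first two coordinates. -/
theorem eq_of_multiplicity_eq {r : ℕ} {π π' : SignedPerm N} {a a' : SignedSet N → ℤ}
    (h : IsFixedPointFreeInvolution π) (h' : IsFixedPointFreeInvolution π')
    (ha : Compatible π r a) (ha' : Compatible π' r a')
    (hm : multiplicity π a = multiplicity π' a') : π = π' ∧ a = a' := by
  have hcode : code π a = code π' a' := by
    refine eq_of_strictMono_of_mem (multiplicitySet r (multiplicity π a)) ?_ _ _
      (code_strictMono ha) (code_strictMono ha') (code_mem ha) (fun x => ?_)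
    · rw [card_multiplicitySet, sum_multiplicity ha, card_signedSet]
    · rw [hm]; exact code_mem ha' x
  have hx : ∀ x, a x = a' x ∧ a (π.1 x) = a' (π'.1 x) ∧ rank π a x = rank π' a' x := by
    intro x
    have := congrFun hcode x
    simpa only [code, EmbeddingLike.apply_eq_iff_eq, Prod.mk.injEq] using this
  refine ⟨Subtype.ext (Equiv.ext fun x => ?_), funext fun x => (hx x).1⟩
  apply (code_strictMono ha).injective
  conv_rhs => rw [hcode]
  simp only [code, EmbeddingLike.apply_eq_iff_eq, Prod.mk.injEq, h.apply_apply, h'.apply_apply,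
    rank_apply h ha, rank_apply h' ha']
  obtain ⟨h1, h2, h3⟩ := hx x
  exact ⟨h2, h1, h3⟩

end SignedPerm

/-! ### Realising every symmetric matrix -/

namespace SignedPerm

open Finset

theorem symmetrize_swap (m : ℤ × ℤ → ℕ) (c d : ℤ) :
    symmetrize m (d, c) = symmetrize m (c, d) := by
  simp only [symmetrize, Prod.mk.injEq, and_comm]
  ring

theorem symmetrize_neg (m : ℤ × ℤ → ℕ) (c d : ℤ) :
    symmetrize m (-c, -d) = symmetrize m (c, d) := by
  simp only [symmetrize, Prod.mk.injEq, neg_eq_zero, neg_neg]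
  ring

theorem symmetrize_diag {r : ℕ} {m : ℤ × ℤ → ℕ} (hm : ∀ p, p ∉ wedge r → m p = 0) (c : ℤ) :
    symmetrize m (c, c) = if c = 0 then 1 else 0 := by
  have h (e : ℤ) : m (e, e) = 0 := hm _ (by simp [mem_wedge])
  simp [symmetrize, h]

theorem even_symmetrize (m : ℤ × ℤ → ℕ) (c : ℤ) (hc : c ≠ 0) : Even (symmetrize m (c, -c)) := by
  simp only [symmetrize, Prod.mk.injEq, hc, false_and, if_false, neg_neg]
  exact ⟨m (c, -c) + m (-c, c), by ring⟩

theorem exists_strictMono_onto (n r : ℕ) (M : ℤ × ℤ → ℕ)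
    (hM : ∑ p ∈ square r, M p = 1 + 4 * n) :
    ∃ φ : SignedSet (2 * n) → ℤ ×ₗ ℤ ×ₗ ℕ, StrictMono φ ∧ (∀ x, φ x ∈ multiplicitySet r M) ∧
      ∀ e ∈ multiplicitySet r M, ∃ x, φ x = e := by
  have hE : (multiplicitySet r M).card = 4 * n + 1 := by rw [card_multiplicitySet, hM]; ring
  have hΩ : Fintype.card (SignedSet (2 * n)) = 4 * n + 1 := by rw [card_signedSet]; ring
  let φ := (Fintype.orderIsoFinOfCardEq _ hΩ).symm.trans ((multiplicitySet r M).orderIsoOfFin hE)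
  refine ⟨fun x => φ x, fun x y hxy => φ.strictMono hxy, fun x => (φ x).2, fun e he => ?_⟩
  exact ⟨φ.symm ⟨e, he⟩, by simp⟩

theorem exists_coordinates (n r : ℕ) (m : ℤ × ℤ → ℕ)
    (hm : ∀ p, p ∉ wedge r → m p = 0) (hn : ∑ p ∈ wedge r, m p = n) :
    ∃ (C D : SignedSet (2 * n) → ℤ) (K : SignedSet (2 * n) → ℕ),
      (∀ x y, x < y ↔ C x < C y ∨ C x = C y ∧ (D x < D y ∨ D x = D y ∧ K x < K y)) ∧
      (∀ x, (C x, D x) ∈ square r ∧ K x < symmetrize m (C x, D x)) ∧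
      (∀ c d k, (c, d) ∈ square r → k < symmetrize m (c, d) → ∃ x, C x = c ∧ D x = d ∧ K x = k) ∧
      ∀ x, C (-x) = -C x ∧ D (-x) = -D x ∧ K (-x) + K x + 1 = symmetrize m (C x, D x) := by
  have hsum := sum_symmetrize r m hm
  rw [hn] at hsum
  obtain ⟨φ, hφ, hmem, honto⟩ := exists_strictMono_onto n r _ hsum
  let C : SignedSet (2 * n) → ℤ := fun x => (ofLex (φ x)).1
  let D : SignedSet (2 * n) → ℤ := fun x => (ofLex (ofLex (φ x)).2).1
  let K : SignedSet (2 * n) → ℕ := fun x => (ofLex (ofLex (φ x)).2).2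
  have hφe : ∀ x, φ x = toLex (C x, toLex (D x, K x)) := fun x => rfl
  have hlt : ∀ x y, x < y ↔ C x < C y ∨ C x = C y ∧ (D x < D y ∨ D x = D y ∧ K x < K y) := by
    intro x y
    rw [← hφ.lt_iff_lt, hφe, hφe, Prod.Lex.toLex_lt_toLex]
    simp only [Prod.Lex.toLex_lt_toLex]
  have hE : ∀ x, (C x, D x) ∈ square r ∧ K x < symmetrize m (C x, D x) := fun x =>
    mem_multiplicitySet.1 (hφe x ▸ hmem x)
  refine ⟨C, D, K, hlt, hE, fun c d k h1 h2 => ?_, ?_⟩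
  · obtain ⟨x, hx⟩ := honto _ (mem_multiplicitySet.2 ⟨h1, h2⟩)
    refine ⟨x, ?_⟩
    simpa [hφe] using hx
  -- Negation reverses Ω, and (c, d, k) ↦ (-c, -d, M(c,d) - 1 - k) reverses the set of triples.
  -- Their composite with φ is again an increasing enumeration, hence equals φ.
  · let ψ : SignedSet (2 * n) → ℤ ×ₗ ℤ ×ₗ ℕ := fun x =>
      toLex (-C (-x), toLex (-D (-x), symmetrize m (C (-x), D (-x)) - 1 - K (-x)))
    have hψ : ψ = φ := by
      refine eq_of_strictMono_of_mem (multiplicitySet r (symmetrize m)) ?_ _ _ ?_ hφ ?_ hmem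
      · rw [card_multiplicitySet, hsum, card_signedSet]; ring
      · intro x y hxy
        have h1 := (hlt _ _).1 ((SignedSet.neg_lt_neg_iff y x).2 hxy)
        have h2 := (hE (-x)).2
        have h3 := (hE (-y)).2
        simp only [ψ, Prod.Lex.toLex_lt_toLex]
        rcases h1 with h1 | ⟨h1, h1' | ⟨h1', h1''⟩⟩
        · left; omega
        · right; exact ⟨by omega, Or.inl (by omega)⟩
        · rw [h1, h1']
          rw [h1, h1'] at h3
          exact Or.inr ⟨rfl, Or.inr ⟨rfl, by omega⟩⟩
      · intro x
        obtain ⟨h1, h2⟩ := hE (-x)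
        rw [mem_multiplicitySet, symmetrize_neg]
        refine ⟨?_, by omega⟩
        rw [mem_square] at h1 ⊢
        simp only at h1 ⊢
        omega
    intro x
    have h := congrFun hψ (-x)
    simp only [hφe, ψ, EmbeddingLike.apply_eq_iff_eq, Prod.mk.injEq, SignedSet.neg_neg] at h
    have := (hE x).2
    exact ⟨h.1.symm, h.2.1.symm, by omega⟩

/-- The involution exchanges C and D and keeps K. The conditions on the diagonal and antidiagonal
exclude π x = x and π x = -x respectively, except at 0. -/
theorem exists_multiplicity_eq (n r : ℕ) (m : ℤ × ℤ → ℕ)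
    (hm : ∀ p, p ∉ wedge r → m p = 0) (hn : ∑ p ∈ wedge r, m p = n) :
    ∃ (π : SignedPerm (2 * n)) (a : SignedSet (2 * n) → ℤ), IsFixedPointFreeInvolution π ∧
      Compatible π r a ∧ multiplicity π a = symmetrize m := by
  obtain ⟨C, D, K, hlt, hE, honto, hneg⟩ := exists_coordinates n r m hm hn
  have hinj : ∀ x y, C x = C y → D x = D y → K x = K y → x = y := by
    intro x y h1 h2 h3
    have e1 := hlt x y
    have e2 := hlt y x
    rcases lt_trichotomy x y with h | h | h
    · have := e1.1 h; omega
    · exact h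
    · have := e2.1 h; omega
  have hswap : ∀ x, ∃ y, C y = D x ∧ D y = C x ∧ K y = K x := by
    intro x
    obtain ⟨h1, h2⟩ := hE x
    refine honto _ _ _ ?_ (by rwa [symmetrize_swap])
    rw [mem_square] at h1 ⊢
    exact h1.symm
  choose f hfC hfD hfK using hswap
  have hff : Function.Involutive f := fun x =>
    hinj _ _ (by rw [hfC, hfD]) (by rw [hfD, hfC]) (by rw [hfK, hfK])
  have hfneg : ∀ x, f (-x) = -f x := by
    intro x
    have h1 := hneg x
    have h2 := hneg (f x)
    rw [hfC, hfD, hfK, symmetrize_swap] at h2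
    refine hinj _ _ ?_ ?_ ?_
    · rw [hfC, h1.2.1, h2.1]
    · rw [hfD, h1.1, h2.2.1]
    · rw [hfK]; omega
  let π : SignedPerm (2 * n) := ⟨hff.toPerm, hfneg⟩
  have hπ : ∀ x, π.1 x = f x := fun x => rfl
  have hzero : ∀ x, C x = 0 → D x = 0 → x = pos 0 := by
    intro x hc hd
    have h1 := hneg x
    have h2 := (hE x).2
    rw [hc, hd, symmetrize_diag hm, if_pos rfl] at h1 h2
    -- The cell (0, 0) has multiplicity 1, so x and -x both have K = 0.
    have h3 : -x = x := hinj _ _ (by omega) (by omega) (by omega)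
    have h4 := congrArg Subtype.val h3
    apply Subtype.ext
    simp only [SignedSet.coe_neg, coe_pos, Fin.val_zero] at h4 ⊢
    omega
  refine ⟨π, C, isFixedPointFreeInvolution_iff.2 ⟨hff, fun x hx => ⟨fun h => hx ?_, fun h => ?_⟩⟩,
    ⟨fun x => (hneg x).1, ?_, fun x => ?_⟩, ?_⟩
  · rw [hπ] at h
    have h1 := hfC x
    rw [h] at h1
    have h2 := (hE x).2
    rw [← h1, symmetrize_diag hm] at h2
    split_ifs at h2 with h3
    · exact hzero x h3 (h1 ▸ h3)
    · omega
  -- If f x = -x, then D x = -C x and K (-x) = K x, so the multiplicity at (c, -c) is 2 K x + 1,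
  -- which is odd.
  · rw [hπ] at h
    have h1 := hfC x
    have h2 := hfK x
    obtain ⟨h3, -, h4⟩ := hneg x
    rw [h] at h1 h2
    rw [h3] at h1
    rw [← h1] at h4
    by_cases hc : C x = 0
    · exact hx (hzero x hc (by omega))
    · obtain ⟨q, hq⟩ := even_symmetrize m (C x) hc
      omega
  · intro x y hxy
    have h1 := (hlt x y).1 hxy
    rw [Prod.Lex.toLex_lt_toLex]
    simp only [hπ, hlt, hfC, hfD, hfK]
    omega
  · have := (mem_square.1 (hE x).1).1.2
    exact this
  · funext ⟨c, d⟩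
    by_cases hcd : (c, d) ∈ square r
    · rw [multiplicity, ← card_range (symmetrize m (c, d))]
      refine card_nbij K ?_ ?_ ?_
      · intro x hx
        have hx' := (mem_filter.1 hx).2
        rw [hπ, hfC] at hx'
        have := (hE x).2
        rw [hx'.1, hx'.2] at this
        exact mem_range.2 this
      · intro x hx y hy hxy
        have hx' := (mem_filter.1 hx).2
        have hy' := (mem_filter.1 hy).2
        rw [hπ, hfC] at hx' hy'
        exact hinj x y (hx'.1.trans hy'.1.symm) (hx'.2.trans hy'.2.symm) hxy
      · intro k hk
        obtain ⟨x, h1, h2, h3⟩ := honto c d k hcd (mem_range.1 (mem_coe.1 hk))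
        exact ⟨x, mem_coe.2 (mem_filter.2 ⟨mem_univ _, h1, by rw [hπ, hfC]; exact h2⟩), h3⟩
    · rw [symmetrize_eq_zero r m hm _ hcd, multiplicity, card_eq_zero, filter_eq_empty_iff]
      rintro x - ⟨h1, h2⟩
      rw [hπ, hfC] at h2
      apply hcd
      have := (hE x).1
      rwa [h1, h2] at this

/-! ### The double count and the main theorem -/

/-- Folding is a bijection onto multiplicities on the wedge. Their total is n because 1 + 4·total =
|Ω| = 4n + 1, so stars and bars applies. -/
theorem ncard_involution_compatible (n r : ℕ) :
    {p : SignedPerm (2 * n) × (SignedSet (2 * n) → ℤ) |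
      IsFixedPointFreeInvolution p.1 ∧ Compatible p.1 r p.2}.ncard =
      (r * (r + 1) + n - 1).choose n := by
  rw [← card_wedge, ← card_finsuppAntidiag_nat_eq_choose, ← Set.ncard_coe_finset]
  have hfold : ∀ M p, fold r M p ≠ 0 → p ∈ wedge r := by
    intro M p hp
    by_contra h
    exact hp (if_neg h)
  refine Set.ncard_congr (fun p _ => Finsupp.onFinset (wedge r) (fold r (multiplicity p.1 p.2))
    (hfold _)) ?_ ?_ ?_
  · rintro ⟨π, a⟩ ⟨h, ha⟩
    rw [mem_coe, mem_finsuppAntidiag]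
    refine ⟨?_, Finsupp.support_onFinset_subset⟩
    change ∑ p ∈ wedge r, fold r (multiplicity π a) p = n
    have h1 := sum_symmetrize r (fold r (multiplicity π a)) fun p hp => if_neg hp
    rw [symmetrize_fold_multiplicity h ha, sum_multiplicity ha] at h1
    omega
  · rintro ⟨π, a⟩ ⟨π', a'⟩ ⟨h, ha⟩ ⟨h', ha'⟩ he
    have h1 : fold r (multiplicity π a) = fold r (multiplicity π' a') :=
      congrArg (fun f : ℤ × ℤ →₀ ℕ => (f : ℤ × ℤ → ℕ)) he
    have h2 := congrArg symmetrize h1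
    rw [symmetrize_fold_multiplicity h ha, symmetrize_fold_multiplicity h' ha'] at h2
    obtain ⟨rfl, rfl⟩ := eq_of_multiplicity_eq h h' ha ha' h2
    rfl
  · intro m hm
    rw [mem_coe, mem_finsuppAntidiag] at hm
    have hsupp : ∀ p, p ∉ wedge r → m p = 0 := fun p hp => by
      by_contra h0
      exact hp (hm.2 (Finsupp.mem_support_iff.2 h0))
    obtain ⟨π, a, h, ha, hM⟩ := exists_multiplicity_eq n r m hsupp hm.1
    refine ⟨(π, a), ⟨h, ha⟩, ?_⟩
    ext p
    simp only [Finsupp.onFinset_apply]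
    rw [hM, fold_symmetrize r m hsupp]

theorem finite_compatible {N : ℕ} (π : SignedPerm N) (r : ℕ) : {a | Compatible π r a}.Finite := by
  refine (Set.Finite.pi' fun _ : SignedSet N => Set.finite_Icc (-(r : ℤ)) r).subset fun a ha x => ?_
  exact (mem_square.1 (ha.mem_square x x)).1

theorem ncard_involution_compatible_eq_sum (N r : ℕ) [Fintype (SignedPerm N)]
    [DecidablePred (IsFixedPointFreeInvolution (n := N))] :
    {p : SignedPerm N × (SignedSet N → ℤ) |
      IsFixedPointFreeInvolution p.1 ∧ Compatible p.1 r p.2}.ncard =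
      ∑ π : SignedPerm N with IsFixedPointFreeInvolution π, (r + N - des π).choose N := by
  let e : {p : SignedPerm N × (SignedSet N → ℤ) |
      IsFixedPointFreeInvolution p.1 ∧ Compatible p.1 r p.2} ≃
      Σ π : {π : SignedPerm N // IsFixedPointFreeInvolution π}, {a | Compatible π.1 r a} :=
    { toFun := fun p => ⟨⟨p.1.1, p.2.1⟩, ⟨p.1.2, p.2.2⟩⟩
      invFun := fun q => ⟨(q.1.1, q.2.1), q.1.2, q.2.2⟩
      left_inv := fun _ => rfl
      right_inv := fun _ => rfl }
  have (π : {π : SignedPerm N // IsFixedPointFreeInvolution π}) :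
      Finite {a | Compatible π.1 r a} := finite_compatible π.1 r
  rw [← Nat.card_coe_set_eq, Nat.card_congr e, Nat.card_sigma,
    ← sum_subtype_eq_sum_filter, subtype_univ]
  refine sum_congr rfl fun π _ => ?_
  rw [Nat.card_coe_set_eq, ncard_compatible]

theorem sum_numFPFInvolutions_mul (n r : ℕ) (hn : 1 ≤ n) :
    ∑ k ∈ range (r + 1), (numFPFInvolutions (2 * n) k : ℤ) *
      ((r + 2 * n - k).choose (2 * n) : ℕ) = ((r * (r + 1) + n - 1).choose n : ℕ) := by
  classical
  let _ : Fintype (SignedPerm (2 * n)) := Fintype.ofFinite _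
  rw [← ncard_involution_compatible, ncard_involution_compatible_eq_sum]
  have hJ : ∀ k : ℕ, numFPFInvolutions (2 * n) k =
      ∑ π : SignedPerm (2 * n) with IsFixedPointFreeInvolution π, if des π = k then 1 else 0 := by
    intro k
    rw [← card_filter, filter_filter, numFPFInvolutions, ← Set.ncard_coe_finset]
    congr 1
    ext π
    simp
  simp only [hJ]
  push_cast
  simp only [sum_mul, ite_mul, one_mul, zero_mul]
  rw [sum_comm]
  refine sum_congr rfl fun π _ => ?_
  rw [sum_ite_eq]
  split_ifs with h
  · rfl
  -- Permutations with more than r descents lie outside the range but contribute C(r+2n-des, 2n) =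
  -- 0; with truncated subtraction this needs n ≥ 1.
  · rw [Nat.choose_eq_zero_of_lt, Nat.cast_zero]
    rw [mem_range] at h
    omega

theorem numFPFInvolutions_of_neg (n : ℕ) (k : ℤ) (hk : k < 0) : numFPFInvolutions n k = 0 := by
  rw [numFPFInvolutions]
  convert Set.ncard_empty (SignedPerm n)
  ext π
  simp only [Set.mem_ofPred_eq, Set.mem_empty_iff_false, iff_false, not_and]
  intro _ h
  omega

end SignedPerm

theorem mainTheorem6 :
    (∀ (n : ℕ) (k : ℤ), 2 ≤ n → 0 ≤ k →
      (n : ℤ) * (SignedPerm.numFPFInvolutions (2 * n) k : ℤ) =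
        (k ^ 2 + k + (n : ℤ) - 1) * (SignedPerm.numFPFInvolutions (2 * n - 2) k : ℤ)
        + 2 * ((k - 1) * (2 * (n : ℤ) - k - 1) + (n : ℤ)) *
            (SignedPerm.numFPFInvolutions (2 * n - 2) (k - 1) : ℤ)
        + ((2 * (n : ℤ) - k) * (2 * (n : ℤ) - k + 1) + ((n : ℤ) - 1)) *
            (SignedPerm.numFPFInvolutions (2 * n - 2) (k - 2) : ℤ)) ∧
    SignedPerm.numFPFInvolutions 2 0 = 0 ∧
    SignedPerm.numFPFInvolutions 2 1 = 2 ∧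
    SignedPerm.numFPFInvolutions 2 2 = 0 ∧
    (∀ (n : ℕ) (k : ℤ), 1 ≤ n → k < 0 → SignedPerm.numFPFInvolutions (2 * n) k = 0) := by
  -- For n = 1 the right side is r(r+1); r = 0, 1, 2 give J₀ = 0, 3J₀ + J₁ = 2 and 6J₀ + 3J₁ + J₂ =
  -- 6.
  have h0 := SignedPerm.sum_numFPFInvolutions_mul 1 0 le_rfl
  have h1 := SignedPerm.sum_numFPFInvolutions_mul 1 1 le_rfl
  have h2 := SignedPerm.sum_numFPFInvolutions_mul 1 2 le_rfl
  simp [Finset.sum_range_succ, Nat.choose] at h0 h1 h2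
  rw [h0] at h1 h2
  refine ⟨fun n k hn hk => ?_, h0, by omega, by omega,
    fun n k _ hk => SignedPerm.numFPFInvolutions_of_neg _ k hk⟩
  lift k to ℕ using hk
  have hn2 : 2 * (n - 1) = 2 * n - 2 := by omega
  refine recurrence_of_sum_choose n hn (fun k => SignedPerm.numFPFInvolutions (2 * n) k)
    (fun k => SignedPerm.numFPFInvolutions (2 * n - 2) k)
    (fun k hk => by rw [SignedPerm.numFPFInvolutions_of_neg _ k hk, Nat.cast_zero])
    (fun r => SignedPerm.sum_numFPFInvolutions_mul n r (by omega)) (fun r => ?_) k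
  have := SignedPerm.sum_numFPFInvolutions_mul (n - 1) r (by omega)
  rwa [hn2] at this
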